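/- Let $0<\lambda<1$. Put $h_0=1$ and $h_{k+1}=4h_k+1$. Define columns $C_k$ (ordered lists of $h_k$ pairwise disjoint bounded half-open intervals, called levels) as follows. $C_0$ consists of the single interval $[0,1)$. Given $C_k$, cut every level $[a,a+\ell)$ of $C_k$ into a left piece $[a,a+\frac{\ell}{1+\lambda})$ and a right piece $[a+\frac{\ell}{1+\lambda},a+\ell)$, so that the length of the right piece is $\lambda$ times that of the left piece; then $C_{k+1}$ consists, from bottom to top, of the left pieces of the levels of $C_k$ in order, the right pieces of the levels of $C_k$ in order, and $2h_k+1$ new intervals (spacers). The spacers of all stages may be any half-open intervals of positive finite length that are pairwise disjoint and disjoint from $[0,1)$. Let $X$ be the union of all levels of all columns, with its Borel $\sigma$-algebra $\mathcal B$ and Lebesgue measure $\mu$. Let $S=S_\lambda:X\to X$ be the common extension of the column maps, where the column map of $C_k$ sends each level other than the top one onto the next level by the orientation-preserving affine map. ($S$ is called the nonsingular HK$(+1,\lambda)$ transformation.) Then $S$ is an invertible nonsingular transformation of $(X,\mathcal B,\mu)$: it is injective, measurable, with measurable images of measurable sets, $\mu(X\setminus S(X))=0$, and $\mu(A)=0$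 if and only if $\mu(S^{-1}A)=0$ for every $A\in\mathcal B$. It is ergodic: if $A\in\mathcal B$ and $\mu(S^{-1}A\bigtriangleup A)=0$, then $\mu(A)=0$ or $\mu(X\setminus A)=0$. Finally, it is of type $\mathrm{III}_\lambda$: with $\omega_n=\frac{d(\mu\circ S^n)}{d\mu}$, where $(\mu\circ S^n)(A)=\mu(S^nA)$, its ratio set $$r(S)=\bigl\{t\in[0,\infty): \text{for all } A\in\mathcal B \text{ with } \mu(A)>0 \text{ and all } \varepsilon>0 \text{ there is } n\ge 1 \text{ with } \mu\bigl(A\cap S^{-n}A\cap\{x:|\omega_n(x)-t|<\varepsilon\}\bigr)>0\bigr\}$$ equals $\{\lambda^n:n\in\mathbb Z\}\cup\{0\}$. -/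

import Mathlib

open MeasureTheory Set

namespace HKOne

/-- The heights of the columns: `h 0 = 1` and `h (k+1) = 4 h k + 1`. -/
def height : ℕ → ℕ
  | 0 => 1
  | k + 1 => 4 * height k + 1

/-- A half-open interval `[lo, lo + len)`. -/
structure Itv where
  lo : ℝ
  len : ℝ

namespace Itv

/-- The points of the interval. -/
def toSet (I : Itv) : Set ℝ := Ico I.lo (I.lo + I.len)

/-- The left piece when `I` is cut so that (right piece) / (left piece) is `lam`. -/
noncomputable def leftPiece (lam : ℝ) (I : Itv) : Itv := ⟨I.lo, I.len / (1 + lam)⟩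

/-- The right piece when `I` is cut so that (right piece) / (left piece) is `lam`. -/
noncomputable def rightPiece (lam : ℝ) (I : Itv) : Itv :=
  ⟨I.lo + I.len / (1 + lam), lam * (I.len / (1 + lam))⟩

/-- The orientation preserving affine map that sends `I` onto `J`. -/
noncomputable def affine (I J : Itv) (x : ℝ) : ℝ := J.lo + J.len / I.len * (x - I.lo)

end Itv

/-- A choice of spacers. At stage `k` the spacers `spacer k j`, `j < 2 h k + 1`, are added; they are
non-degenerate bounded intervals, and all spacers of all stages are pairwise disjoint and disjoint
from the initial interval `[0, 1)`. Their lengths and positions are otherwise arbitrary. -/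
structure Spacers where
  spacer : ℕ → ℕ → Itv
  len_pos : ∀ k j, j < 2 * height k + 1 → 0 < (spacer k j).len
  disjoint_unit : ∀ k j, j < 2 * height k + 1 → Disjoint (Ico (0 : ℝ) 1) (spacer k j).toSet
  disjoint : ∀ k j k' j', j < 2 * height k + 1 → j' < 2 * height k' + 1 → (k, j) ≠ (k', j') →
    Disjoint (spacer k j).toSet (spacer k' j').toSet

/-- `level lam σ k i`, for `i < h k`, is the `i`-th level of the `k`-th column. The column of stage
`k + 1` consists, from bottom to top, of the left pieces of the levels of stage `k`, then their
right pieces, then the `2 h k + 1` spacers of stage `k`. -/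
noncomputable def level (lam : ℝ) (σ : Spacers) : ℕ → ℕ → Itv
  | 0, _ => ⟨0, 1⟩
  | k + 1, i =>
    if i < height k then (level lam σ k i).leftPiece lam
    else if i < 2 * height k then (level lam σ k (i - height k)).rightPiece lam
    else σ.spacer k (i - 2 * height k)

/-- The space `X`: the union of all levels of all columns. -/
def space (lam : ℝ) (σ : Spacers) : Set ℝ :=
  {x | ∃ k i, i < height k ∧ x ∈ (level lam σ k i).toSet}

/-- `x` lies in the level `p.2` of the column `p.1`, and that level is not the top one, so that the
column map of that column is defined at `x`. -/
def BelowTop (lam : ℝ) (σ : Spacers) (x : ℝ) (p : ℕ × ℕ) : Prop :=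
  p.2 + 1 < height p.1 ∧ x ∈ (level lam σ p.1 p.2).toSet

/-- The column map of column `p.1` on its level `p.2`: the affine map onto the next level. -/
noncomputable def columnMap (lam : ℝ) (σ : Spacers) (p : ℕ × ℕ) : ℝ → ℝ :=
  (level lam σ p.1 p.2).affine (level lam σ p.1 (p.2 + 1))

open Classical in
/-- The common extension of all column maps; `mapReal_eq` below shows that it agrees with each
column map wherever that is defined, and `exists_belowTop` that every point of `X` is reached. -/
noncomputable def mapReal (lam : ℝ) (σ : Spacers) (x : ℝ) : ℝ :=
  if hx : ∃ p, BelowTop lam σ x p then columnMap lam σ hx.choose x else x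

theorem len_pos {lam : ℝ} (hlam : 0 < lam) (σ : Spacers) (k : ℕ) :
    ∀ i, i < height k → 0 < (level lam σ k i).len := by
  induction k with
  | zero => intro i _; simp [level]
  | succ k ih =>
    intro i hi
    simp only [height] at hi
    have h1 : 0 < 1 + lam := by linarith
    unfold level
    split_ifs with h2 h3
    · exact div_pos (ih i h2) h1
    · exact mul_pos hlam (div_pos (ih _ (by omega)) h1)
    · exact σ.len_pos k _ (by omega)

theorem Itv.affine_mem {I J : Itv} (hI : 0 < I.len) (hJ : 0 < J.len) {x : ℝ} (hx : x ∈ I.toSet) :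
    I.affine J x ∈ J.toSet := by
  obtain ⟨h1, h2⟩ := hx
  have h3 : 0 ≤ x - I.lo := by linarith
  have h4 : J.len / I.len * (x - I.lo) < J.len := by
    rw [div_mul_eq_mul_div, div_lt_iff₀ hI]
    exact mul_lt_mul_of_pos_left (by linarith) hJ
  have h5 : 0 ≤ J.len / I.len * (x - I.lo) := by positivity
  constructor <;> simp only [Itv.affine] <;> linarith

theorem mapReal_mapsTo {lam : ℝ} (hlam : 0 < lam) (σ : Spacers) :
    MapsTo (mapReal lam σ) (space lam σ) (space lam σ) := by
  intro x hx
  unfold mapReal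
  split_ifs with h
  · obtain ⟨h1, h2⟩ := h.choose_spec
    exact ⟨h.choose.1, h.choose.2 + 1, h1, Itv.affine_mem (len_pos hlam σ _ _ (by omega))
      (len_pos hlam σ _ _ h1) h2⟩
  · exact hx

theorem level_left (lam : ℝ) (σ : Spacers) {k i : ℕ} (hi : i < height k) :
    level lam σ (k + 1) i = (level lam σ k i).leftPiece lam := by
  simp [level, hi]

theorem level_right (lam : ℝ) (σ : Spacers) {k i : ℕ} (hi : i < height k) :
    level lam σ (k + 1) (i + height k) = (level lam σ k i).rightPiece lam := by
  have h1 : i + height k < 2 * height k := by omega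
  simp [level, h1]

theorem level_spacer (lam : ℝ) (σ : Spacers) (k j : ℕ) :
    level lam σ (k + 1) (j + 2 * height k) = σ.spacer k j := by
  have h1 : ¬ (j + 2 * height k < height k) := by omega
  simp [level, h1]

theorem Itv.leftPiece_subset {lam : ℝ} (hlam : 0 < lam) {I : Itv} (hI : 0 < I.len) :
    (I.leftPiece lam).toSet ⊆ I.toSet := by
  intro x hx
  obtain ⟨h1, h2⟩ := hx
  simp only [Itv.leftPiece] at h1 h2
  have : I.len / (1 + lam) ≤ I.len := div_le_self hI.le (by linarith)
  exact ⟨h1, by linarith⟩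

theorem Itv.pieces_sum {lam : ℝ} (hlam : 0 < lam) (I : Itv) :
    I.len / (1 + lam) + lam * (I.len / (1 + lam)) = I.len := by
  field_simp

theorem Itv.rightPiece_subset {lam : ℝ} (hlam : 0 < lam) {I : Itv} (hI : 0 < I.len) :
    (I.rightPiece lam).toSet ⊆ I.toSet := by
  intro x hx
  obtain ⟨h1, h2⟩ := hx
  simp only [Itv.rightPiece] at h1 h2
  have := I.pieces_sum hlam
  have : 0 < I.len / (1 + lam) := by positivity
  exact ⟨by linarith, by linarith⟩

theorem Itv.mem_pieces {lam : ℝ} (hlam : 0 < lam) {I : Itv} {x : ℝ} (hx : x ∈ I.toSet) :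
    x ∈ (I.leftPiece lam).toSet ∨ x ∈ (I.rightPiece lam).toSet := by
  obtain ⟨h1, h2⟩ := hx
  have := I.pieces_sum hlam
  by_cases h : x < I.lo + I.len / (1 + lam)
  · exact Or.inl ⟨h1, h⟩
  · right
    push Not at h
    exact ⟨h, by simp only [Itv.rightPiece]; linarith⟩

theorem Itv.disjoint_pieces (lam : ℝ) (I : Itv) :
    Disjoint (I.leftPiece lam).toSet (I.rightPiece lam).toSet := by
  rw [Set.disjoint_left]
  rintro x ⟨_, h1⟩ ⟨h2, _⟩
  simp only [Itv.leftPiece, Itv.rightPiece] at h1 h2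
  linarith

/-- The three kinds of levels of column `k + 1`. -/
theorem level_succ_cases {k i : ℕ} (hi : i < height (k + 1)) :
    i < height k ∨ (∃ j, j < height k ∧ i = j + height k) ∨
      ∃ j, j < 2 * height k + 1 ∧ i = j + 2 * height k := by
  simp only [height] at hi
  by_cases h1 : i < height k
  · exact Or.inl h1
  by_cases h2 : i < 2 * height k
  · exact Or.inr (Or.inl ⟨i - height k, by omega, by omega⟩)
  · exact Or.inr (Or.inr ⟨i - 2 * height k, by omega, by omega⟩)

theorem level_disjoint_spacer {lam : ℝ} (hlam : 0 < lam) (σ : Spacers) (k : ℕ) :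
    ∀ i, i < height k → ∀ k' j, k ≤ k' → j < 2 * height k' + 1 →
      Disjoint (level lam σ k i).toSet (σ.spacer k' j).toSet := by
  induction k with
  | zero =>
    intro i _ k' j _ hj
    simpa [level, Itv.toSet] using σ.disjoint_unit k' j hj
  | succ k ih =>
    intro i hi k' j hk hj
    rcases level_succ_cases hi with h | ⟨i, h, rfl⟩ | ⟨i, h, rfl⟩
    · rw [level_left lam σ h]
      exact (ih i h k' j (by omega) hj).mono_left (Itv.leftPiece_subset hlam (len_pos hlam σ k i h))
    · rw [level_right lam σ h]
      exact (ih i h k' j (by omega) hj).mono_left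
        (Itv.rightPiece_subset hlam (len_pos hlam σ k i h))
    · rw [level_spacer]
      refine σ.disjoint k i k' j h hj ?_
      intro h'
      simp only [Prod.mk.injEq] at h'
      omega

/-- Distinct levels of one column are disjoint. -/
theorem level_index_unique {lam : ℝ} (hlam : 0 < lam) (σ : Spacers) (k : ℕ) :
    ∀ i j, i < height k → j < height k → ∀ x, x ∈ (level lam σ k i).toSet →
      x ∈ (level lam σ k j).toSet → i = j := by
  induction k with
  | zero => intro i j hi hj; simp only [height] at hi hj; omega
  | succ k ih =>
    have hl := fun i h => Itv.leftPiece_subset hlam (len_pos hlam σ k i h)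
    have hr := fun i h => Itv.rightPiece_subset hlam (len_pos hlam σ k i h)
    have hs := level_disjoint_spacer hlam σ k
    intro i j hi hj x hxi hxj
    rcases level_succ_cases hi with h | ⟨i, h, rfl⟩ | ⟨i, h, rfl⟩ <;>
      rcases level_succ_cases hj with h' | ⟨j, h', rfl⟩ | ⟨j, h', rfl⟩
    all_goals
      first
      | rw [level_left lam σ h] at hxi
      | rw [level_right lam σ h] at hxi
      | rw [level_spacer] at hxi
      first
      | rw [level_left lam σ h'] at hxj
      | rw [level_right lam σ h'] at hxj
      | rw [level_spacer] at hxj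
    · exact ih i j h h' x (hl i h hxi) (hl j h' hxj)
    · obtain rfl := ih i j h h' x (hl i h hxi) (hr j h' hxj)
      exact (Set.disjoint_left.1 (Itv.disjoint_pieces _ _) hxi hxj).elim
    · exact (Set.disjoint_left.1 (hs i h k j le_rfl h') (hl i h hxi) hxj).elim
    · obtain rfl := ih i j h h' x (hr i h hxi) (hl j h' hxj)
      exact (Set.disjoint_left.1 (Itv.disjoint_pieces _ _) hxj hxi).elim
    · rw [ih i j h h' x (hr i h hxi) (hr j h' hxj)]
    · exact (Set.disjoint_left.1 (hs i h k j le_rfl h') (hr i h hxi) hxj).elim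
    · exact (Set.disjoint_left.1 (hs j h' k i le_rfl h) (hl j h' hxj) hxi).elim
    · exact (Set.disjoint_left.1 (hs j h' k i le_rfl h) (hr j h' hxj) hxi).elim
    · by_contra hne
      refine Set.disjoint_left.1 (σ.disjoint k i k j h h' ?_) hxi hxj
      intro h2
      simp only [Prod.mk.injEq, true_and] at h2
      omega

/-- The column map of column `k + 1` extends that of column `k`. -/
theorem columnMap_succ {lam : ℝ} (hlam : 0 < lam) (σ : Spacers) {x : ℝ} {k i : ℕ}
    (h : BelowTop lam σ x (k, i)) :
    ∃ j, BelowTop lam σ x (k + 1, j) ∧ columnMap lam σ (k + 1, j) x = columnMap lam σ (k, i) x := by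
  obtain ⟨h1, h2⟩ := h
  simp only at h1 h2
  have hp := len_pos hlam σ k i (by omega)
  have hlam1 : (1 + lam) ≠ 0 := by positivity
  have hlam0 : lam ≠ 0 := hlam.ne'
  have hp0 := hp.ne'
  rcases Itv.mem_pieces hlam h2 with h3 | h3
  · refine ⟨i, ⟨by simp only [height]; omega, by rwa [level_left lam σ (by omega)]⟩, ?_⟩
    simp only [columnMap]
    rw [level_left lam σ (by omega), level_left lam σ h1]
    simp only [Itv.affine, Itv.leftPiece]
    field_simp
  · refine ⟨i + height k, ⟨by simp only [height]; omega, by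
      rwa [level_right lam σ (by omega)]⟩, ?_⟩
    simp only [columnMap]
    rw [level_right lam σ (by omega), show i + height k + 1 = (i + 1) + height k by omega,
      level_right lam σ h1]
    simp only [Itv.affine, Itv.rightPiece]
    field_simp
    ring

theorem columnMap_le {lam : ℝ} (hlam : 0 < lam) (σ : Spacers) {x : ℝ} {k i : ℕ}
    (h : BelowTop lam σ x (k, i)) (m : ℕ) :
    ∃ j, BelowTop lam σ x (k + m, j) ∧ columnMap lam σ (k + m, j) x = columnMap lam σ (k, i) x := by
  induction m with
  | zero => exact ⟨i, h, rfl⟩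
  | succ m ih =>
    obtain ⟨j, hj, hj'⟩ := ih
    obtain ⟨j', h1, h2⟩ := columnMap_succ hlam σ hj
    exact ⟨j', h1, h2.trans hj'⟩

/-- `mapReal` agrees with every column map wherever that column map is defined. -/
theorem mapReal_eq {lam : ℝ} (hlam : 0 < lam) (σ : Spacers) {x : ℝ} {p : ℕ × ℕ}
    (h : BelowTop lam σ x p) : mapReal lam σ x = columnMap lam σ p x := by
  have hex : ∃ p, BelowTop lam σ x p := ⟨p, h⟩
  rw [mapReal, dif_pos hex]
  obtain ⟨j, h1, h2⟩ := columnMap_le hlam σ hex.choose_spec p.1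
  obtain ⟨j', h3, h4⟩ := columnMap_le hlam σ h hex.choose.1
  rw [add_comm] at h3 h4
  have hj := level_index_unique hlam σ _ j j' (Nat.lt_of_succ_lt h1.1) (Nat.lt_of_succ_lt h3.1)
    x h1.2 h3.2
  subst hj
  exact h2.symm.trans h4

/-- Some column map is defined at every point of `X`. -/
theorem exists_belowTop {lam : ℝ} (hlam : 0 < lam) (σ : Spacers) {x : ℝ}
    (hx : x ∈ space lam σ) : ∃ p, BelowTop lam σ x p := by
  obtain ⟨k, i, hi, hx⟩ := hx
  rcases Itv.mem_pieces hlam hx with h | h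
  · exact ⟨(k + 1, i), by simp only [height]; omega, by rwa [level_left lam σ hi]⟩
  · exact ⟨(k + 1, i + height k), by simp only [height]; omega, by rwa [level_right lam σ hi]⟩

/-- The measure on `X`: Lebesgue measure. -/
noncomputable def measure (lam : ℝ) (σ : Spacers) : Measure (space lam σ) :=
  Measure.comap Subtype.val volume

/-- The nonsingular HK`(+1, lam)` transformation `S` of the space `X`. -/
noncomputable def transformation {lam : ℝ} (hlam : 0 < lam) (σ : Spacers) :
    space lam σ → space lam σ :=
  (mapReal_mapsTo hlam σ).restrict (mapReal lam σ) (space lam σ) (space lam σ)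

end HKOne

namespace NonsingularDynamics

/-- `T` is an invertible nonsingular transformation of `(X, μ)`: it is one-to-one, measurable with
measurable inverse, onto up to a null set, and `A` is null if and only if `T⁻¹ A` is null. -/
structure IsInvertibleNonsingular {X : Type*} [MeasurableSpace X] (T : X → X) (μ : Measure X) :
    Prop where
  measurableEmbedding : MeasurableEmbedding T
  range_conull : μ (range T)ᶜ = 0
  null_iff : ∀ A, MeasurableSet A → (μ A = 0 ↔ μ (T ⁻¹' A) = 0)

/-- Ergodicity: every almost invariant measurable set is null or conull. -/
def IsErgodic {X : Type*} [MeasurableSpace X] (T : X → X) (μ : Measure X) : Prop :=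
  ∀ A, MeasurableSet A → μ (symmDiff (T ⁻¹' A) A) = 0 → μ A = 0 ∨ μ Aᶜ = 0

/-- The Radon-Nikodym derivative `ω_n = d(μ ∘ T^n) / dμ`, where `(μ ∘ T^n)(A) = μ (T^n A)` (for an
injective `T` with measurable images). -/
noncomputable def omega {X : Type*} [MeasurableSpace X] (T : X → X) (μ : Measure X) (n : ℕ)
    (x : X) : ℝ :=
  ((μ.comap T^[n]).rnDeriv μ x).toReal

/-- The ratio set of `T`. -/
def ratioSet {X : Type*} [MeasurableSpace X] (T : X → X) (μ : Measure X) : Set ℝ :=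
  {t | 0 ≤ t ∧ ∀ A, MeasurableSet A → 0 < μ A → ∀ ε : ℝ, 0 < ε →
    ∃ n : ℕ, 0 < n ∧ 0 < μ (A ∩ T^[n] ⁻¹' A ∩ {x | |omega T μ n x - t| < ε})}

/-- `T` is of type III with parameter `lam`: its ratio set is `{lam ^ n : n ∈ ℤ} ∪ {0}`. -/
def IsTypeIII {X : Type*} [MeasurableSpace X] (T : X → X) (μ : Measure X) (lam : ℝ) : Prop :=
  ratioSet T μ = {t | ∃ n : ℤ, t = lam ^ n} ∪ {0}

end NonsingularDynamics

open scoped Pointwise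

namespace HKOne

/-! Everything is read off inside a single column. The levels of stage `k` occupy only the lower `2
h_k` levels of column `k + 1`, so each point eventually lies at least `n` levels below the top.
There `S^n` is the affine map from one level onto another: it scales measure by the ratio of the two
lengths, and this ratio is `ω_n`. Nonsingularity follows by summing over countably many levels, and
the only point that `S` can miss is `0`, where the bottom levels shrink.

For ergodicity, Lebesgue density (`exists_level_diff_lt`) shows that a set of positive measure fills
most of some level of every late column. If `A` and its complement both had positive measure, each
would fill more than half of a level of one common column. An invariant set has the same proportion
in all levels of a column, a contradiction.

For the ratio set, every level contains two sublevels, of relative size bounded below, whose lengths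
have ratio `λ^m` (`exists_sublevels`). A set that almost fills the level almost fills both, so it
returns with `ω_n = λ^m`; hence every `λ^m` is a ratio, and so is the limit `0`. Conversely, spacer
lengths cancel for returns to `[0,1)`: all levels meeting it have length `λ^a / (1+λ)^k`, so only
powers of `λ` occur (`exists_omega_eq_zpow`). -/

theorem le_height (k : ℕ) : k < height k := by
  induction k with
  | zero => simp [height]
  | succ k ih => simp only [height]; omega

/-! ### Intervals and the affine maps between them -/

theorem measurableSet_toSet (I : Itv) : MeasurableSet I.toSet := measurableSet_Ico

theorem Itv.volume_toSet (I : Itv) : volume I.toSet = ENNReal.ofReal I.len := by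
  simp [Itv.toSet]

theorem Itv.affine_self {I : Itv} (hI : I.len ≠ 0) (x : ℝ) : I.affine I x = x := by
  simp [Itv.affine, hI]

theorem Itv.affine_affine {I J K : Itv} (hJ : J.len ≠ 0) (x : ℝ) :
    J.affine K (I.affine J x) = I.affine K x := by
  simp only [Itv.affine]
  field_simp
  ring

theorem Itv.affine_injective {I J : Itv} (hI : I.len ≠ 0) (hJ : J.len ≠ 0) :
    Function.Injective (I.affine J) := by
  intro x y h
  have h1 : J.len / I.len ≠ 0 := div_ne_zero hJ hI
  simp only [Itv.affine, add_right_inj] at h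
  have := mul_left_cancel₀ h1 h
  linarith

theorem Itv.continuous_affine (I J : Itv) : Continuous (I.affine J) := by
  unfold Itv.affine
  fun_prop

theorem Itv.volume_image_affine {I J : Itv} (hI : 0 < I.len) (hJ : 0 < J.len) (B : Set ℝ) :
    volume (I.affine J '' B) = ENNReal.ofReal (J.len / I.len) * volume B := by
  have h : I.affine J '' B =
      (fun y => (J.lo - J.len / I.len * I.lo) + y) '' ((J.len / I.len) • B) := by
    rw [← image_smul, image_image]
    refine image_congr fun x _ => ?_
    simp only [Itv.affine, smul_eq_mul]
    ring
  rw [h, image_add_left, measure_preimage_add, Measure.addHaar_smul]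
  simp [abs_of_pos (div_pos hJ hI)]

/-! ### The space, its measure and its levels -/

variable {lam : ℝ} (hlam : 0 < lam) (σ : Spacers)

theorem measurableSet_space : MeasurableSet (space lam σ) := by
  have : space lam σ = ⋃ k, ⋃ i, ⋃ _ : i < height k, (level lam σ k i).toSet := by
    ext x
    simp [space]
  rw [this]
  exact MeasurableSet.iUnion fun k => MeasurableSet.iUnion fun i => MeasurableSet.iUnion fun _ =>
    measurableSet_toSet _

theorem measure_apply (B : Set (space lam σ)) :
    measure lam σ B = volume (Subtype.val '' B) :=
  (MeasurableEmbedding.subtype_coe (measurableSet_space σ)).comap_apply _ _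

/-- The `i`-th level of the `k`-th column as a set of points of `X`. -/
def levelSet (lam : ℝ) (σ : Spacers) (k i : ℕ) : Set (space lam σ) :=
  Subtype.val ⁻¹' (level lam σ k i).toSet

theorem measurableSet_levelSet (k i : ℕ) : MeasurableSet (levelSet lam σ k i) :=
  measurable_subtype_coe (measurableSet_toSet _)

theorem image_val_levelSet {k i : ℕ} (hi : i < height k) :
    Subtype.val '' levelSet lam σ k i = (level lam σ k i).toSet := by
  rw [levelSet, Subtype.image_preimage_coe]
  exact inter_eq_right.2 fun x hx => ⟨k, i, hi, hx⟩

theorem measure_levelSet {k i : ℕ} (hi : i < height k) :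
    measure lam σ (levelSet lam σ k i) = ENNReal.ofReal (level lam σ k i).len := by
  rw [measure_apply, image_val_levelSet σ hi, Itv.volume_toSet]

theorem measure_levelSet_ne_top {k i : ℕ} (hi : i < height k) (B : Set (space lam σ)) :
    measure lam σ (levelSet lam σ k i ∩ B) ≠ ⊤ :=
  ((measure_mono inter_subset_left).trans_lt
    (by rw [measure_levelSet σ hi]; exact ENNReal.ofReal_lt_top)).ne

include hlam in
/-- The level of the next column that contains a given point of a level. -/
theorem exists_level_succ {x : ℝ} {k i : ℕ} (hi : i < height k)
    (hx : x ∈ (level lam σ k i).toSet) :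
    ∃ j, j < 2 * height k ∧ x ∈ (level lam σ (k + 1) j).toSet := by
  rcases Itv.mem_pieces hlam hx with h | h
  · exact ⟨i, by omega, by rwa [level_left lam σ hi]⟩
  · exact ⟨i + height k, by omega, by rwa [level_right lam σ hi]⟩

include hlam in
theorem exists_level_add {x : ℝ} {k i : ℕ} (hi : i < height k)
    (hx : x ∈ (level lam σ k i).toSet) (n : ℕ) :
    ∃ j, j < height (k + n) ∧ x ∈ (level lam σ (k + n) j).toSet := by
  induction n with
  | zero => exact ⟨i, hi, hx⟩
  | succ n ih =>
    obtain ⟨j, hj, hxj⟩ := ih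
    obtain ⟨j', hj', h⟩ := exists_level_succ hlam σ hj hxj
    exact ⟨j', by rw [← add_assoc, height]; omega, h⟩

include hlam in
/-- Every point is eventually at least `n` levels below the top of its column. -/
theorem eventually_exists_level {x : ℝ} (hx : x ∈ space lam σ) (n : ℕ) :
    ∃ K, ∀ k, K ≤ k → ∃ i, i + n < height k ∧ x ∈ (level lam σ k i).toSet := by
  obtain ⟨k₀, i₀, hi₀, hx₀⟩ := hx
  refine ⟨k₀ + n + 1, fun k hk => ?_⟩
  obtain ⟨m, rfl⟩ : ∃ m, k = k₀ + (n + m) + 1 := ⟨k - (k₀ + n + 1), by omega⟩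
  obtain ⟨j, hj, hxj⟩ := exists_level_add hlam σ hi₀ hx₀ (n + m)
  obtain ⟨j', hj', h⟩ := exists_level_succ hlam σ hj hxj
  -- Above the first `2h` of the `4h + 1` levels there remain at least `2h + 1`, and `h > k₀ + n + m
  -- ≥ n`.
  refine ⟨j', ?_, h⟩
  have := le_height (k₀ + (n + m))
  rw [height]
  omega

/-! ### The action of the iterates inside a column -/

/-- Inside one column, the iterates of `S` act by the affine maps between the levels. -/
theorem transformation_iterate {x : space lam σ} {k i n : ℕ} (hi : i + n < height k)
    (hx : x ∈ levelSet lam σ k i) :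
    (((transformation hlam σ)^[n] x : space lam σ) : ℝ) =
      (level lam σ k i).affine (level lam σ k (i + n)) x := by
  induction n with
  | zero => exact (Itv.affine_self (len_pos hlam σ k i hi).ne' _).symm
  | succ n ih =>
    have h1 := ih (by omega)
    have h2 : ((transformation hlam σ)^[n] x : ℝ) ∈ (level lam σ k (i + n)).toSet := by
      rw [h1]
      exact Itv.affine_mem (len_pos hlam σ k i (by omega)) (len_pos hlam σ k _ (by omega)) hx
    rw [Function.iterate_succ_apply']
    change mapReal lam σ ((transformation hlam σ)^[n] x : space lam σ) = _
    rw [mapReal_eq hlam σ (p := (k, i + n)) ⟨by simpa [add_assoc] using hi, h2⟩, columnMap, h1,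
      Itv.affine_affine (len_pos hlam σ k _ (by omega)).ne']
    rfl

theorem transformation_iterate_mem {x : space lam σ} {k i n : ℕ} (hi : i + n < height k)
    (hx : x ∈ levelSet lam σ k i) :
    (transformation hlam σ)^[n] x ∈ levelSet lam σ k (i + n) := by
  change (((transformation hlam σ)^[n] x : space lam σ) : ℝ) ∈ (level lam σ k (i + n)).toSet
  rw [transformation_iterate hlam σ hi hx]
  exact Itv.affine_mem (len_pos hlam σ k i (by omega)) (len_pos hlam σ k _ hi) hx

theorem measure_image_iterate {k i n : ℕ} (hi : i + n < height k) {B : Set (space lam σ)}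
    (hB : B ⊆ levelSet lam σ k i) :
    measure lam σ ((transformation hlam σ)^[n] '' B) =
      ENNReal.ofReal ((level lam σ k (i + n)).len / (level lam σ k i).len) * measure lam σ B := by
  rw [measure_apply, measure_apply, ← Itv.volume_image_affine (len_pos hlam σ k i (by omega))
    (len_pos hlam σ k _ hi), image_image, image_image]
  congr 1
  exact image_congr fun x hx => transformation_iterate hlam σ hi (hB hx)

/-- Two points can be placed below the top of one common column. If their images agree, disjointness
of the levels puts both points in the same level, where `S` is a single injective affine map. -/
theorem transformation_injective : Function.Injective (transformation hlam σ) := by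
  intro x y h
  obtain ⟨K, hK⟩ := eventually_exists_level hlam σ x.2 1
  obtain ⟨K', hK'⟩ := eventually_exists_level hlam σ y.2 1
  obtain ⟨i, hi, hxi⟩ := hK (max K K') (le_max_left _ _)
  obtain ⟨j, hj, hyj⟩ := hK' (max K K') (le_max_right _ _)
  have h1 := transformation_iterate hlam σ hi hxi
  have h2 := transformation_iterate hlam σ hj hyj
  have h3 := transformation_iterate_mem hlam σ hi hxi
  have h4 := transformation_iterate_mem hlam σ hj hyj
  simp only [Function.iterate_one] at h1 h2 h3 h4
  rw [← h] at h4 h2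
  have h5 := level_index_unique hlam σ _ _ _ hi hj _ h3 h4
  obtain rfl : i = j := by omega
  exact Subtype.ext (Itv.affine_injective (len_pos hlam σ _ i (by omega)).ne'
    (len_pos hlam σ _ _ hi).ne' (h1.symm.trans h2))

theorem measurable_transformation : Measurable (transformation hlam σ) := by
  refine Measurable.subtype_mk (f := fun x : space lam σ => mapReal lam σ x) ?_
  intro B hB
  have h : (fun x : space lam σ => mapReal lam σ x) ⁻¹' B = ⋃ k, ⋃ i, ⋃ _ : i + 1 < height k,
      levelSet lam σ k i ∩ (fun x : space lam σ => columnMap lam σ (k, i) x) ⁻¹' B := by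
    ext x
    simp only [mem_preimage, mem_iUnion, mem_inter_iff, exists_prop]
    constructor
    · intro hx
      obtain ⟨p, hp⟩ := exists_belowTop hlam σ x.2
      rw [mapReal_eq hlam σ hp] at hx
      exact ⟨p.1, p.2, hp.1, hp.2, hx⟩
    · rintro ⟨k, i, hi, hx, hxB⟩
      rwa [mapReal_eq hlam σ (p := (k, i)) ⟨hi, hx⟩]
  rw [h]
  exact MeasurableSet.iUnion fun k => MeasurableSet.iUnion fun i => MeasurableSet.iUnion fun _ =>
    (measurableSet_levelSet σ k i).inter
      (((Itv.continuous_affine _ _).measurable.comp measurable_subtype_coe) hB)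

/-- Lusin–Souslin: an injective Borel map on a standard Borel space has measurable images. -/
theorem measurableEmbedding_transformation : MeasurableEmbedding (transformation hlam σ) :=
  haveI := (measurableSet_space (lam := lam) σ).standardBorel
  (measurable_transformation hlam σ).measurableEmbedding (transformation_injective hlam σ)

theorem measurableEmbedding_iterate (n : ℕ) :
    MeasurableEmbedding (transformation hlam σ)^[n] := by
  induction n with
  | zero => exact MeasurableEmbedding.id
  | succ n ih => exact ih.comp (measurableEmbedding_transformation hlam σ)

/-! ### Null sets and nonsingularity -/

include hlam in
/-- A set is null as soon as its trace on every level at distance at least `n` from the top is. -/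
theorem measure_eq_zero_of_levels (ν : Measure (space lam σ)) (n : ℕ) {B : Set (space lam σ)}
    (h : ∀ k i, i + n < height k → ν (levelSet lam σ k i ∩ B) = 0) : ν B = 0 := by
  have hB : B ⊆ ⋃ k, ⋃ i, ⋃ _ : i + n < height k, levelSet lam σ k i ∩ B := by
    intro x hx
    obtain ⟨K, hK⟩ := eventually_exists_level hlam σ x.2 n
    obtain ⟨i, hi, hxi⟩ := hK K le_rfl
    simp only [mem_iUnion]
    exact ⟨K, i, hi, hxi, hx⟩
  refine measure_mono_null hB ?_
  simp only [measure_iUnion_null_iff]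
  exact h

theorem level_zero_eq (k : ℕ) : level lam σ k 0 = ⟨0, 1 / (1 + lam) ^ k⟩ := by
  induction k with
  | zero => simp [level]
  | succ k ih =>
    rw [level_left lam σ (by have := le_height k; omega), ih, Itv.leftPiece, pow_succ, div_div]

theorem exists_preimage {y : space lam σ} {k i : ℕ} (hi : i + 1 < height k)
    (hy : y ∈ levelSet lam σ k (i + 1)) : y ∈ range (transformation hlam σ) := by
  have hp := len_pos hlam σ k i (by omega)
  have hp' := len_pos hlam σ k (i + 1) hi
  have hx := Itv.affine_mem hp' hp hy
  let x : space lam σ := ⟨_, k, i, by omega, hx⟩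
  refine ⟨x, Subtype.ext ?_⟩
  have := transformation_iterate hlam σ (x := x) (n := 1) hi hx
  rw [Function.iterate_one] at this
  rw [this, Itv.affine_affine hp.ne', Itv.affine_self hp'.ne']

/-- A point outside the range can never lie in a level above the bottom one, so it lies in the
bottom level of every late column. These are the intervals `[0, (1+λ)^(-k))`, whose intersection is
`{0}`. -/
theorem measure_compl_range : measure lam σ (range (transformation hlam σ))ᶜ = 0 := by
  rw [measure_apply]
  refine measure_mono_null (t := {0}) ?_ Real.volume_singleton
  rintro _ ⟨x, hx, rfl⟩
  obtain ⟨K, hK⟩ := eventually_exists_level hlam σ x.2 0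
  have key : ∀ k, K ≤ k → x ∈ levelSet lam σ k 0 := by
    intro k hk
    obtain ⟨i, hi, hxi⟩ := hK k hk
    rcases i with _ | i
    · exact hxi
    · exact (hx (exists_preimage hlam σ hi hxi)).elim
  simp only [levelSet, mem_preimage, level_zero_eq, Itv.toSet, mem_Ico, zero_add] at key
  by_contra hne
  have hpos : 0 < (x : ℝ) := lt_of_le_of_ne (key K le_rfl).1 (fun h => hne h.symm)
  obtain ⟨n, hn⟩ := exists_pow_lt_of_lt_one hpos
    (show 1 / (1 + lam) < 1 by rw [div_lt_one (by linarith)]; linarith)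
  have h1 := (key (K + n) (by omega)).2
  have h2 : 1 / (1 + lam) ^ (K + n) ≤ (1 / (1 + lam)) ^ n := by
    rw [div_pow, one_pow]
    exact one_div_le_one_div_of_le (by positivity) (pow_le_pow_right₀ (by linarith) (by omega))
  linarith

/-- On each level at least `n` below the top, `S^n` multiplies measure by a positive constant, and
countably many such levels cover the space. -/
theorem measure_image_iterate_eq_zero_iff (n : ℕ) (B : Set (space lam σ)) :
    measure lam σ ((transformation hlam σ)^[n] '' B) = 0 ↔ measure lam σ B = 0 := by
  have key : ∀ k i, i + n < height k → (measure lam σ ((transformation hlam σ)^[n] ''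
      (levelSet lam σ k i ∩ B)) = 0 ↔ measure lam σ (levelSet lam σ k i ∩ B) = 0) := by
    intro k i hi
    have h0 : 0 < (level lam σ k (i + n)).len / (level lam σ k i).len :=
      div_pos (len_pos hlam σ k _ hi) (len_pos hlam σ k i (by omega))
    rw [measure_image_iterate hlam σ hi inter_subset_left, mul_eq_zero]
    simp only [ENNReal.ofReal_eq_zero, not_le.2 h0, false_or]
  have hc := (measurableEmbedding_iterate hlam σ n).comap_apply (measure lam σ)
  constructor
  · intro h
    refine measure_eq_zero_of_levels hlam σ _ n fun k i hi => (key k i hi).1 ?_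
    exact measure_mono_null (image_mono inter_subset_right) h
  · intro h
    rw [← hc]
    refine measure_eq_zero_of_levels hlam σ _ n fun k i hi => ?_
    rw [hc]
    exact (key k i hi).2 (measure_mono_null inter_subset_right h)

theorem isInvertibleNonsingular : NonsingularDynamics.IsInvertibleNonsingular
    (transformation hlam σ) (measure lam σ) where
  measurableEmbedding := measurableEmbedding_transformation hlam σ
  range_conull := measure_compl_range hlam σ
  null_iff A _ := by
    -- `S(S⁻¹A) = A ∩ S(X)`, which differs from `A` by a null set.
    rw [← measure_image_iterate_eq_zero_iff hlam σ 1 (_ ⁻¹' A), Function.iterate_one,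
      image_preimage_eq_inter_range, measure_inter_conull']
    exact measure_mono_null (fun x hx => hx.2) (measure_compl_range hlam σ)

theorem quasiMeasurePreserving_transformation :
    Measure.QuasiMeasurePreserving (transformation hlam σ) (measure lam σ) (measure lam σ) :=
  ⟨measurable_transformation hlam σ, Measure.AbsolutelyContinuous.mk fun A hA h => by
    rw [Measure.map_apply (measurable_transformation hlam σ) hA]
    exact ((isInvertibleNonsingular hlam σ).null_iff A hA).1 h⟩

/-! ### The Radon–Nikodym derivatives of the iterates -/

include hlam in
theorem measureReal_levelSet {k i : ℕ} (hi : i < height k) :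
    (measure lam σ).real (levelSet lam σ k i) = (level lam σ k i).len := by
  rw [measureReal_def, measure_levelSet σ hi, ENNReal.toReal_ofReal (len_pos hlam σ k i hi).le]

theorem measure_levelSet_lt_top {k i : ℕ} (hi : i < height k) :
    measure lam σ (levelSet lam σ k i) < ⊤ := by
  rw [measure_levelSet σ hi]
  exact ENNReal.ofReal_lt_top

include hlam in
-- The margin `n` serves the pullback of the measure under `S^n`, whose value on a level is
-- controlled only if the level is at least `n` below the top.
theorem sigmaFinite_of_levels (ν : Measure (space lam σ)) (n : ℕ)
    (h : ∀ k i, i + n < height k → ν (levelSet lam σ k i) < ⊤) : SigmaFinite ν := by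
  refine Measure.sigmaFinite_of_countable
    (S := {s | ∃ k i, i + n < height k ∧ s = levelSet lam σ k i}) ?_ ?_ ?_
  · refine (countable_range fun p : ℕ × ℕ => levelSet lam σ p.1 p.2).mono ?_
    rintro _ ⟨k, i, _, rfl⟩
    exact ⟨(k, i), rfl⟩
  · rintro _ ⟨k, i, hi, rfl⟩
    exact h k i hi
  · refine eq_univ_of_forall fun x => ?_
    obtain ⟨K, hK⟩ := eventually_exists_level hlam σ x.2 n
    obtain ⟨i, hi, hxi⟩ := hK K le_rfl
    exact ⟨_, ⟨K, i, hi, rfl⟩, hxi⟩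

include hlam in
theorem sigmaFinite_measure : SigmaFinite (measure lam σ) :=
  sigmaFinite_of_levels hlam σ _ 0 fun _ _ hi => measure_levelSet_lt_top σ hi

theorem sigmaFinite_comap_iterate (n : ℕ) :
    SigmaFinite ((measure lam σ).comap (transformation hlam σ)^[n]) := by
  refine sigmaFinite_of_levels hlam σ _ n fun k i hi => ?_
  rw [(measurableEmbedding_iterate hlam σ n).comap_apply,
    measure_image_iterate hlam σ hi Subset.rfl]
  exact ENNReal.mul_lt_top ENNReal.ofReal_lt_top (measure_levelSet_lt_top σ (by omega))

theorem restrict_comap_iterate {k i n : ℕ} (hi : i + n < height k) :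
    ((measure lam σ).comap (transformation hlam σ)^[n]).restrict (levelSet lam σ k i) =
      ENNReal.ofReal ((level lam σ k (i + n)).len / (level lam σ k i).len) •
        (measure lam σ).restrict (levelSet lam σ k i) := by
  ext B hB
  rw [Measure.restrict_apply hB, Measure.smul_apply, Measure.restrict_apply hB,
    (measurableEmbedding_iterate hlam σ n).comap_apply,
    measure_image_iterate hlam σ hi inter_subset_right, smul_eq_mul]

/-- On a level, `ω_n` is the ratio of the lengths of the image level and of the level. -/
theorem omega_ae : ∀ᵐ x ∂measure lam σ, ∀ n k i, i + n < height k → x ∈ levelSet lam σ k i →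
    NonsingularDynamics.omega (transformation hlam σ) (measure lam σ) n x =
      (level lam σ k (i + n)).len / (level lam σ k i).len := by
  simp only [ae_all_iff]
  intro n k i hi
  have := sigmaFinite_measure hlam σ
  have := sigmaFinite_comap_iterate hlam σ n
  have : IsFiniteMeasure ((measure lam σ).restrict (levelSet lam σ k i)) :=
    isFiniteMeasure_restrict.2 (measure_levelSet_lt_top σ (by omega)).ne
  have hm := measurableSet_levelSet (lam := lam) σ k i
  have h1 := Measure.rnDeriv_restrict ((measure lam σ).comap (transformation hlam σ)^[n])
    (measure lam σ) hm
  rw [restrict_comap_iterate hlam σ hi] at h1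
  have h2 := Measure.rnDeriv_smul_left_of_ne_top ((measure lam σ).restrict (levelSet lam σ k i))
    (measure lam σ) (r := ENNReal.ofReal ((level lam σ k (i + n)).len / (level lam σ k i).len))
    ENNReal.ofReal_ne_top
  have h3 := Measure.rnDeriv_restrict_self (measure lam σ) hm
  filter_upwards [h1, h2, h3] with x h1 h2 h3 hx
  rw [indicator_of_mem hx] at h1 h3
  rw [NonsingularDynamics.omega, ← h1, h2, Pi.smul_apply, h3, Pi.one_apply, smul_eq_mul, mul_one,
    ENNReal.toReal_ofReal]
  exact (div_pos (len_pos hlam σ k _ hi) (len_pos hlam σ k i (by omega))).le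

/-- The proportion of a level taken up by `S⁻ⁿ B` is at most that of `B` in the image level. -/
theorem measureReal_preimage_mul_le {k i n : ℕ} (hi : i + n < height k) (B : Set (space lam σ)) :
    (measure lam σ).real (levelSet lam σ k i ∩ (transformation hlam σ)^[n] ⁻¹' B) *
        (level lam σ k (i + n)).len ≤
      (measure lam σ).real (levelSet lam σ k (i + n) ∩ B) * (level lam σ k i).len := by
  have hp := len_pos hlam σ k i (by omega)
  have hp' := len_pos hlam σ k (i + n) hi
  have h1 := measure_image_iterate hlam σ hi
    (B := levelSet lam σ k i ∩ (transformation hlam σ)^[n] ⁻¹' B) inter_subset_left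
  -- This inclusion is in fact an equality, but one inequality suffices, since it can be applied to
  -- a set or to its complement.
  have h2 : (transformation hlam σ)^[n] '' (levelSet lam σ k i ∩
      (transformation hlam σ)^[n] ⁻¹' B) ⊆ levelSet lam σ k (i + n) ∩ B := by
    rintro _ ⟨x, ⟨hx, hxB⟩, rfl⟩
    exact ⟨transformation_iterate_mem hlam σ hi hx, hxB⟩
  have h3 := measureReal_mono h2 (measure_levelSet_ne_top σ hi B)
  rw [measureReal_def, h1, ENNReal.toReal_mul, ENNReal.toReal_ofReal (div_pos hp' hp).le,
    ← measureReal_def, div_mul_eq_mul_div, div_le_iff₀ hp] at h3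
  linarith

/-! ### Lebesgue density along the levels -/

include hlam in
/-- Passing to later columns, the levels shrink geometrically around a given point of a level. -/
theorem exists_level_add_len_le (hlam1 : lam < 1) {x : ℝ} {k i : ℕ} (hi : i < height k)
    (hx : x ∈ (level lam σ k i).toSet) (n : ℕ) :
    ∃ j, j < height (k + n) ∧ x ∈ (level lam σ (k + n) j).toSet ∧
      (level lam σ (k + n) j).len ≤ (level lam σ k i).len * (1 / (1 + lam)) ^ n := by
  induction n with
  | zero => exact ⟨i, hi, hx, by simp⟩
  | succ n ih =>
    obtain ⟨j, hj, hxj, hlen⟩ := ih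
    have hp := len_pos hlam σ _ j hj
    have h1 : (level lam σ (k + n) j).len / (1 + lam) ≤
        (level lam σ k i).len * (1 / (1 + lam)) ^ (n + 1) := by
      rw [pow_succ, ← mul_assoc, ← div_eq_mul_one_div]
      gcongr
    rcases Itv.mem_pieces hlam hxj with h | h
    · refine ⟨j, by rw [← add_assoc, height]; omega, ?_, ?_⟩
      · rwa [← add_assoc, level_left lam σ hj]
      · rwa [← add_assoc, level_left lam σ hj]
    · refine ⟨j + height (k + n), by rw [← add_assoc, height]; omega, ?_, ?_⟩
      · rwa [← add_assoc, level_right lam σ hj]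
      · rw [← add_assoc, level_right lam σ hj]
        refine le_trans ?_ h1
        have : 0 ≤ (level lam σ (k + n) j).len / (1 + lam) := by positivity
        simp only [Itv.rightPiece]
        nlinarith

/-- The density theorem is about closed balls; a level is one up to an endpoint. -/
theorem Itv.toSet_ae_eq_closedBall (I : Itv) :
    I.toSet =ᵐ[volume] Metric.closedBall (I.lo + I.len / 2) (I.len / 2) := by
  have h1 : I.lo + I.len / 2 - I.len / 2 = I.lo := by ring
  have h2 : I.lo + I.len / 2 + I.len / 2 = I.lo + I.len := by ring
  rw [Real.closedBall_eq_Icc, Itv.toSet, h1, h2]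
  exact Ico_ae_eq_Icc

include hlam in
/-- A set of positive measure fills almost all of some level of every late enough column. -/
theorem exists_level_diff_lt (hlam1 : lam < 1) {A : Set (space lam σ)} (hA : MeasurableSet A)
    (hpos : 0 < measure lam σ A) {δ : ℝ} (hδ : 0 < δ) :
    ∃ K, ∀ k, K ≤ k → ∃ i, i < height k ∧
      (measure lam σ).real (levelSet lam σ k i ∩ Aᶜ) < δ * (level lam σ k i).len := by
  -- This form of the density theorem allows balls not centred at the point. The levels around `x`
  -- are such balls and contain `x` themselves, so the dilation factor `1` is enough.
  have hdens := IsUnifLocDoublingMeasure.ae_tendsto_measure_inter_div (volume : Measure ℝ)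
    (Subtype.val '' A) 1
  have hS : MeasurableSet (Subtype.val '' A) :=
    (MeasurableEmbedding.subtype_coe (measurableSet_space σ)).measurableSet_image.2 hA
  rw [ae_restrict_iff' hS] at hdens
  rw [measure_apply] at hpos
  obtain ⟨x, hxA, hx⟩ : ∃ x ∈ Subtype.val '' A, _ :=
    ((frequently_ae_mem_iff.2 hpos.ne').and_eventually hdens).exists
  obtain ⟨x, hxA, rfl⟩ := hxA
  obtain ⟨k₀, i₀, hi₀, hx₀⟩ := x.2
  choose j hj hxj hlen using exists_level_add_len_le hlam σ hlam1 hi₀ hx₀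
  have hlp : ∀ n, 0 < (level lam σ (k₀ + n) (j n)).len := fun n => len_pos hlam σ _ _ (hj n)
  have hlim : Filter.Tendsto (fun n => (level lam σ (k₀ + n) (j n)).len / 2) Filter.atTop
      (nhdsWithin 0 (Ioi 0)) := by
    refine tendsto_nhdsWithin_iff.2 ⟨?_, Filter.Eventually.of_forall fun n => half_pos (hlp n)⟩
    have h1 := (tendsto_pow_atTop_nhds_zero_of_lt_one (r := 1 / (1 + lam)) (by positivity)
      (by rw [div_lt_one (by linarith)]; linarith)).const_mul (level lam σ k₀ i₀).len
    rw [mul_zero] at h1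
    have h2 := squeeze_zero (fun n => (hlp n).le) hlen h1
    simpa using h2.div_const 2
  have h := hx ⟨x, hxA, rfl⟩ (fun n => (level lam σ (k₀ + n) (j n)).lo + (level lam σ (k₀ + n) (j n)).len / 2) _
    hlim (Filter.Eventually.of_forall fun n => by
      rw [one_mul, Real.closedBall_eq_Icc]
      obtain ⟨h1, h2⟩ := hxj n
      constructor <;> linarith)
  have h' := (ENNReal.tendsto_toReal ENNReal.one_ne_top).comp h
  have hev := h'.eventually (lt_mem_nhds (show 1 - δ < (1 : ENNReal).toReal by simpa using hδ))
  obtain ⟨N, hN⟩ := Filter.eventually_atTop.1 hev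
  refine ⟨k₀ + N, fun k hk => ?_⟩
  obtain ⟨n, rfl⟩ : ∃ n, k = k₀ + n := ⟨k - k₀, by omega⟩
  refine ⟨j n, hj n, ?_⟩
  have h3 := hN n (by omega)
  have hae := (level lam σ (k₀ + n) (j n)).toSet_ae_eq_closedBall
  have himg : Subtype.val '' (levelSet lam σ (k₀ + n) (j n) ∩ A) =
      Subtype.val '' A ∩ (level lam σ (k₀ + n) (j n)).toSet := by
    rw [image_inter Subtype.val_injective, image_val_levelSet σ (hj n), inter_comm]
  simp only [Function.comp_apply] at h3
  rw [← measure_congr hae, ← measure_congr ((Filter.EventuallyEq.refl _ _).inter hae), ← himg,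
    ← measure_apply, ← image_val_levelSet σ (hj n), ← measure_apply, ENNReal.toReal_div,
    ← measureReal_def, ← measureReal_def, measureReal_levelSet hlam σ (hj n),
    lt_div_iff₀ (hlp n)] at h3
  have h4 := measureReal_inter_add_sdiff (μ := measure lam σ)
    (s := levelSet lam σ (k₀ + n) (j n)) hA (measure_levelSet_lt_top σ (hj n)).ne
  rw [measureReal_levelSet hlam σ (hj n), sdiff_eq] at h4
  linarith

/-! ### Ergodicity -/

theorem isErgodic (hlam1 : lam < 1) :
    NonsingularDynamics.IsErgodic (transformation hlam σ) (measure lam σ) := by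
  intro A hA hinv
  by_contra! hne
  have hinvA : transformation hlam σ ⁻¹' A =ᵐ[measure lam σ] A :=
    measure_symmDiff_eq_zero_iff.1 hinv
  -- The proportion of an invariant `B` does not decrease from level `i` up to level `j`, so it
  -- cannot exceed one half in the former and be below one half in the latter.
  have key : ∀ B : Set (space lam σ), MeasurableSet B →
      transformation hlam σ ⁻¹' B =ᵐ[measure lam σ] B → ∀ k i j, i ≤ j → j < height k →
      (measure lam σ).real (levelSet lam σ k i ∩ Bᶜ) < 1 / 2 * (level lam σ k i).len →
      (measure lam σ).real (levelSet lam σ k j ∩ B) < 1 / 2 * (level lam σ k j).len → False := by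
    intro B hB hinvB k i j hij hj h1 h2
    obtain ⟨n, rfl⟩ := Nat.exists_eq_add_of_le hij
    have hp := len_pos hlam σ k i (by omega)
    have hp' := len_pos hlam σ k (i + n) hj
    have h3 := measureReal_preimage_mul_le hlam σ hj B
    have h4 := (quasiMeasurePreserving_transformation hlam σ).preimage_iterate_ae_eq n hinvB
    rw [measureReal_congr ((Filter.EventuallyEq.refl _ _).inter h4)] at h3
    have h5 := measureReal_inter_add_sdiff (μ := measure lam σ)
      (s := levelSet lam σ k i) hB (measure_levelSet_lt_top σ (by omega)).ne
    rw [measureReal_levelSet hlam σ (by omega), sdiff_eq] at h5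
    have h6 := mul_lt_mul_of_pos_right h2 hp
    have h7 : 1 / 2 * (level lam σ k i).len < (measure lam σ).real (levelSet lam σ k i ∩ B) := by
      linarith
    have h8 := mul_lt_mul_of_pos_right h7 hp'
    linarith
  obtain ⟨K, hK⟩ := exists_level_diff_lt hlam σ hlam1 hA (pos_iff_ne_zero.2 hne.1)
    (half_pos one_pos)
  obtain ⟨K', hK'⟩ := exists_level_diff_lt hlam σ hlam1 hA.compl (pos_iff_ne_zero.2 hne.2)
    (half_pos one_pos)
  obtain ⟨i, hi, h1⟩ := hK (max K K') (le_max_left _ _)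
  obtain ⟨j, hj, h2⟩ := hK' (max K K') (le_max_right _ _)
  -- `S^n` only moves upwards; if the level filled by `A` is the upper one, `A` and its complement
  -- exchange roles.
  rcases le_total i j with hij | hij
  · exact key A hA hinvA _ i j hij hj h1 (by rwa [compl_compl] at h2)
  · exact key Aᶜ hA.compl hinvA.compl _ j i hij hi h2 h1

/-! ### Sublevels with prescribed length ratio, and returns -/

include hlam in
/-- The level of column `k + n` made of the leftmost pieces of a level of column `k`. -/
theorem level_left_iterate {k i : ℕ} (hi : i < height k) (n : ℕ) :
    i < height (k + n) ∧ (level lam σ (k + n) i).toSet ⊆ (level lam σ k i).toSet ∧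
      (level lam σ (k + n) i).len = (level lam σ k i).len / (1 + lam) ^ n := by
  induction n with
  | zero => exact ⟨hi, Subset.rfl, by simp⟩
  | succ n ih =>
    obtain ⟨h1, h2, h3⟩ := ih
    rw [← add_assoc, level_left lam σ h1]
    refine ⟨by rw [height]; omega,
      (Itv.leftPiece_subset hlam (len_pos hlam σ _ _ h1)).trans h2, ?_⟩
    rw [Itv.leftPiece, h3, div_div, pow_succ]

include hlam in
/-- The level of column `k + n` made of the rightmost pieces of a level of column `k`. -/
theorem level_right_iterate {k i : ℕ} (hi : i < height k) (n : ℕ) :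
    ∃ j, i ≤ j ∧ (0 < n → i < j) ∧ j < height (k + n) ∧
      (level lam σ (k + n) j).toSet ⊆ (level lam σ k i).toSet ∧
      (level lam σ (k + n) j).len = lam ^ n * (level lam σ k i).len / (1 + lam) ^ n := by
  induction n with
  | zero => exact ⟨i, le_rfl, by simp, hi, Subset.rfl, by simp⟩
  | succ n ih =>
    obtain ⟨j, h0, -, h1, h2, h3⟩ := ih
    have := le_height (k + n)
    refine ⟨j + height (k + n), by omega, by omega, by rw [← add_assoc, height]; omega, ?_⟩
    rw [← add_assoc, level_right lam σ h1]
    refine ⟨(Itv.rightPiece_subset hlam (len_pos hlam σ _ _ h1)).trans h2, ?_⟩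
    rw [Itv.rightPiece, h3, pow_succ, pow_succ]
    field_simp

include hlam in
/-- Inside every level there are two sublevels, of a size that is bounded below relative to the
level, such that the upper one is `lam ^ m` times as long as the lower one. -/
theorem exists_sublevels (m : ℤ) : ∃ n, ∃ c : ℝ, 0 < c ∧ ∀ k i, i < height k →
    ∃ p q, p < q ∧ q < height (k + n) ∧
      (level lam σ (k + n) p).toSet ⊆ (level lam σ k i).toSet ∧
      (level lam σ (k + n) q).toSet ⊆ (level lam σ k i).toSet ∧
      c * (level lam σ k i).len ≤ (level lam σ (k + n) p).len ∧
      c * (level lam σ k i).len ≤ (level lam σ (k + n) q).len ∧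
      (level lam σ (k + n) q).len = lam ^ m * (level lam σ (k + n) p).len := by
  rcases lt_or_ge 0 m with hm | hm
  · lift m to ℕ using hm.le
    -- For `m > 0` the leftmost piece after `m` cuts lies below the rightmost one, and their lengths
    -- are as `1` to `λ^m`.
    refine ⟨m, min 1 (lam ^ m) / (1 + lam) ^ m, by positivity, fun k i hi => ?_⟩
    have hp := len_pos hlam σ k i hi
    obtain ⟨h1, h2, h3⟩ := level_left_iterate hlam σ hi m
    obtain ⟨j, -, hij, g1, g2, g3⟩ := level_right_iterate hlam σ hi m
    refine ⟨i, j, hij (by omega), g1, h2, g2, ?_, ?_, ?_⟩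
    · rw [h3, div_mul_eq_mul_div]
      gcongr
      exact mul_le_of_le_one_left hp.le (min_le_left _ _)
    · rw [g3, div_mul_eq_mul_div]
      gcongr
      exact min_le_right _ _
    · rw [g3, h3, zpow_natCast]
      ring
  -- For `m = -N ≤ 0` the longer piece must be on top. After `N + 1` cuts, one more cut reverses the
  -- order: the right piece of the leftmost level lies above the left piece of the rightmost one.
  -- Their relative lengths, `λ` and `λ^(N+1)` over `(1+λ)^(N+2)`, have ratio `λ^(-N)`.
  · obtain ⟨N, rfl⟩ : ∃ N : ℕ, m = 1 - (N + 1 : ℕ) := ⟨m.natAbs, by omega⟩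
    refine ⟨N + 1 + 1, min lam (lam ^ (N + 1)) / (1 + lam) ^ (N + 1 + 1), by positivity,
      fun k i hi => ?_⟩
    have hp := len_pos hlam σ k i hi
    obtain ⟨h1, h2, h3⟩ := level_left_iterate hlam σ hi (N + 1)
    obtain ⟨j, -, -, g1, g2, g3⟩ := level_right_iterate hlam σ hi (N + 1)
    refine ⟨j, i + height (k + (N + 1)), by omega, ?_⟩
    rw [← add_assoc k (N + 1) 1, height, level_left lam σ g1, level_right lam σ h1]
    refine ⟨by omega, (Itv.leftPiece_subset hlam (len_pos hlam σ _ _ g1)).trans g2,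
      (Itv.rightPiece_subset hlam (len_pos hlam σ _ _ h1)).trans h2, ?_, ?_, ?_⟩
    · rw [Itv.leftPiece, g3, div_mul_eq_mul_div, div_div, ← pow_succ]
      dsimp only
      gcongr
      exact min_le_right _ _
    · rw [Itv.rightPiece, h3, div_mul_eq_mul_div, div_div, ← pow_succ, mul_div_assoc']
      dsimp only
      gcongr
      exact min_le_left _ _
    · rw [Itv.rightPiece, Itv.leftPiece, g3, h3, zpow_sub₀ hlam.ne', zpow_natCast, zpow_one]
      field_simp

/-- Every set of positive measure meets some of its preimages in a set of positive measure on which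
the derivative is `lam ^ m`. -/
theorem exists_return (hlam1 : lam < 1) {A : Set (space lam σ)} (hA : MeasurableSet A)
    (hpos : 0 < measure lam σ A) (m : ℤ) : ∃ n : ℕ, 0 < n ∧
      0 < measure lam σ (A ∩ (transformation hlam σ)^[n] ⁻¹' A ∩ {x |
        NonsingularDynamics.omega (transformation hlam σ) (measure lam σ) n x = lam ^ m}) := by
  obtain ⟨n, c, hc, hsub⟩ := exists_sublevels hlam σ m
  -- With `c / 2`, the part of the level outside `A` is less than half of either sublevel, each
  -- being at least `c` times the level.
  obtain ⟨K, hK⟩ := exists_level_diff_lt hlam σ hlam1 hA hpos (half_pos hc)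
  obtain ⟨i, hi, h1⟩ := hK K le_rfl
  obtain ⟨p, q, hpq, hq, hpi, hqi, hpc, hqc, hlen⟩ := hsub K i hi
  obtain ⟨d, rfl⟩ := Nat.exists_eq_add_of_lt hpq
  rw [add_assoc] at *
  refine ⟨d + 1, d.succ_pos, ?_⟩
  have hlp := len_pos hlam σ (K + n) p (by omega)
  have hlq := len_pos hlam σ (K + n) _ hq
  have hsm : ∀ r, (level lam σ (K + n) r).toSet ⊆ (level lam σ K i).toSet →
      (measure lam σ).real (levelSet lam σ (K + n) r ∩ Aᶜ) < c / 2 * (level lam σ K i).len :=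
    fun r hr => (measureReal_mono (inter_subset_inter_left _ (preimage_mono hr))
      (measure_levelSet_ne_top σ hi _)).trans_lt h1
  have hp1 := hsm _ hpi
  have hq1 := hsm _ hqi
  have h2 := measureReal_preimage_mul_le hlam σ hq Aᶜ
  have h3 : (measure lam σ).real (levelSet lam σ (K + n) p ∩
      (transformation hlam σ)^[d + 1] ⁻¹' Aᶜ) < 1 / 2 * (level lam σ (K + n) p).len := by
    have h4 := mul_lt_mul_of_pos_right (hq1.trans_le (show _ ≤ 1 / 2 *
      (level lam σ (K + n) (p + (d + 1))).len by linarith)) hlp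
    refine lt_of_mul_lt_mul_right (h2.trans_lt (h4.trans_eq ?_)) hlq.le
    ring
  rw [pos_iff_ne_zero]
  intro h0
  -- If the return set were null, almost every point of the lower sublevel would be outside `A` or
  -- be sent outside `A`; each of these sets fills less than half of it.
  have hcov : levelSet lam σ (K + n) p ≤ᵐ[measure lam σ]
      (levelSet lam σ (K + n) p ∩ Aᶜ ∪ levelSet lam σ (K + n) p ∩
        (transformation hlam σ)^[d + 1] ⁻¹' Aᶜ : Set _) := by
    filter_upwards [measure_eq_zero_iff_ae_notMem.1 h0, omega_ae hlam σ] with x hx hom hxp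
    have h5 := hom (d + 1) (K + n) p hq hxp
    rw [hlen, mul_div_cancel_right₀ _ hlp.ne'] at h5
    by_contra hcon
    refine hx ⟨⟨?_, ?_⟩, h5⟩
    · by_contra hxA
      exact hcon (Or.inl ⟨hxp, hxA⟩)
    · by_contra hxA
      exact hcon (Or.inr ⟨hxp, hxA⟩)
  have h6 := ENNReal.toReal_mono (measure_union_lt_top
    (measure_levelSet_ne_top σ (by omega) _).lt_top
    (measure_levelSet_ne_top σ (by omega) _).lt_top).ne (measure_mono_ae hcov)
  have h7 := measureReal_union_le (μ := measure lam σ) (levelSet lam σ (K + n) p ∩ Aᶜ)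
    (levelSet lam σ (K + n) p ∩ (transformation hlam σ)^[d + 1] ⁻¹' Aᶜ)
  rw [← measureReal_def, ← measureReal_def, measureReal_levelSet hlam σ (by omega)] at h6
  linarith

/-! ### Ratios of returns to the unit interval -/

include hlam in
/-- The levels that meet `[0, 1)` have length `lam ^ a / (1 + lam) ^ k`. -/
theorem exists_len_eq {x : ℝ} (hx : x ∈ Ico (0 : ℝ) 1) (k : ℕ) : ∀ i, i < height k →
    x ∈ (level lam σ k i).toSet → ∃ a : ℕ, (level lam σ k i).len = lam ^ a / (1 + lam) ^ k := by
  induction k with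
  | zero => exact fun i _ _ => ⟨0, by simp [level]⟩
  | succ k ih =>
    intro i hi hxi
    rcases level_succ_cases hi with h | ⟨i, h, rfl⟩ | ⟨i, h, rfl⟩
    · rw [level_left lam σ h] at hxi ⊢
      obtain ⟨a, ha⟩ := ih i h (Itv.leftPiece_subset hlam (len_pos hlam σ k i h) hxi)
      exact ⟨a, by rw [Itv.leftPiece, ha, div_div, pow_succ]⟩
    · rw [level_right lam σ h] at hxi ⊢
      obtain ⟨a, ha⟩ := ih i h (Itv.rightPiece_subset hlam (len_pos hlam σ k i h) hxi)
      refine ⟨a + 1, ?_⟩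
      rw [Itv.rightPiece, ha, pow_succ, pow_succ]
      field_simp
    · rw [level_spacer] at hxi
      exact (Set.disjoint_left.1 (σ.disjoint_unit k i h) hx hxi).elim

/-- The levels of `x` and `S^n x` in a common column both meet `[0,1)`, so the factors `(1+λ)^k`
cancel in the ratio of their lengths. Without the restriction to `[0,1)` the arbitrary spacer
lengths would enter. -/
theorem exists_omega_eq_zpow : ∀ᵐ x ∂measure lam σ, ∀ n, x ∈ levelSet lam σ 0 0 →
    (transformation hlam σ)^[n] x ∈ levelSet lam σ 0 0 →
    ∃ m : ℤ, NonsingularDynamics.omega (transformation hlam σ) (measure lam σ) n x = lam ^ m := by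
  filter_upwards [omega_ae hlam σ] with x hom n hx hTx
  obtain ⟨K, hK⟩ := eventually_exists_level hlam σ x.2 n
  obtain ⟨i, hi, hxi⟩ := hK K le_rfl
  simp only [levelSet, level, Itv.toSet, zero_add, mem_preimage] at hx hTx
  obtain ⟨a, ha⟩ := exists_len_eq hlam σ hx K i (by omega) hxi
  obtain ⟨b, hb⟩ := exists_len_eq hlam σ hTx K (i + n) hi
    (transformation_iterate_mem hlam σ hi hxi)
  refine ⟨(b : ℤ) - a, ?_⟩
  rw [hom n K i hi hxi, ha, hb, zpow_sub₀ hlam.ne', zpow_natCast, zpow_natCast]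
  field_simp

/-- A positive `t` that is not a power lies strictly between two consecutive powers, and the smaller
of the distances to these two serves as `ε`. -/
theorem exists_forall_zpow_dist (hlam1 : lam < 1) (hlam : 0 < lam) {t : ℝ} (ht : 0 < t)
    (hne : ∀ n : ℤ, t ≠ lam ^ n) : ∃ ε > 0, ∀ m : ℤ, ε ≤ |lam ^ m - t| := by
  obtain ⟨n, h1, h2⟩ := exists_mem_Ico_zpow ht ((one_lt_inv₀ hlam).2 hlam1)
  rw [inv_zpow'] at h1 h2
  have h1' := lt_of_le_of_ne h1 (hne _).symm
  refine ⟨min (t - lam ^ (-n)) (lam ^ (-(n + 1)) - t), lt_min (by linarith) (by linarith),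
    fun m => ?_⟩
  rcases le_or_gt (-n) m with hm | hm
  · have h3 := zpow_le_zpow_right_of_le_one₀ hlam hlam1.le hm
    rw [abs_sub_comm]
    exact (min_le_left _ _).trans ((by linarith : _ ≤ t - lam ^ m).trans (le_abs_self _))
  · have h3 := zpow_le_zpow_right_of_le_one₀ hlam hlam1.le (show m ≤ -(n + 1) by omega)
    exact (min_le_right _ _).trans ((by linarith : _ ≤ lam ^ m - t).trans (le_abs_self _))

/-! ### The ratio set -/

theorem isTypeIII (hlam1 : lam < 1) :
    NonsingularDynamics.IsTypeIII (transformation hlam σ) (measure lam σ) lam := by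
  refine Subset.antisymm ?_ ?_
  · rintro t ⟨ht, h⟩
    by_contra hcon
    simp only [mem_union, mem_ofPred_eq, mem_singleton_iff, not_or, not_exists] at hcon
    obtain ⟨ε, hε, hdist⟩ := exists_forall_zpow_dist hlam1 hlam
      (lt_of_le_of_ne ht (Ne.symm hcon.2)) hcon.1
    -- The test set is `[0,1)`, the only level of the initial column.
    obtain ⟨n, -, hn⟩ := h (levelSet lam σ 0 0) (measurableSet_levelSet σ 0 0)
      (by rw [measure_levelSet σ (by simp [height])]; simp [level]) ε hε
    refine hn.ne' (measure_eq_zero_iff_ae_notMem.2 ?_)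
    filter_upwards [exists_omega_eq_zpow hlam σ] with x hx
    rintro ⟨⟨hx1, hx2⟩, hx3⟩
    obtain ⟨m, hm⟩ := hx n hx1 hx2
    rw [mem_ofPred_eq, hm] at hx3
    exact absurd hx3 (not_lt.2 (hdist m))
  -- Exact returns for every power give every nonnegative limit of powers; `0` is reached through
  -- large positive exponents.
  · have key : ∀ t : ℝ, 0 ≤ t → (∀ ε > 0, ∃ m : ℤ, |lam ^ m - t| < ε) →
        t ∈ NonsingularDynamics.ratioSet (transformation hlam σ) (measure lam σ) := by
      refine fun t ht h => ⟨ht, fun A hA hpos ε hε => ?_⟩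
      obtain ⟨m, hm⟩ := h ε hε
      obtain ⟨n, hn, hmeas⟩ := exists_return hlam σ hlam1 hA hpos m
      refine ⟨n, hn, hmeas.trans_le (measure_mono (inter_subset_inter_right _ fun x hx => ?_))⟩
      rw [mem_ofPred_eq] at hx ⊢
      rwa [hx]
    rintro t (⟨m, rfl⟩ | rfl)
    · exact key _ (zpow_pos hlam m).le fun ε hε => ⟨m, by simpa using hε⟩
    · refine key _ le_rfl fun ε hε => ?_
      obtain ⟨m, hm⟩ := exists_pow_lt_of_lt_one hε hlam1
      exact ⟨m, by rwa [zpow_natCast, sub_zero, abs_of_pos (pow_pos hlam m)]⟩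

end HKOne

theorem mainTheorem4 (lam : ℝ) (hlam : 0 < lam) (hlam1 : lam < 1) (σ : HKOne.Spacers) :
    NonsingularDynamics.IsInvertibleNonsingular (HKOne.transformation hlam σ) (HKOne.measure lam σ) ∧
      NonsingularDynamics.IsErgodic (HKOne.transformation hlam σ) (HKOne.measure lam σ) ∧
      NonsingularDynamics.IsTypeIII (HKOne.transformation hlam σ) (HKOne.measure lam σ) lam :=
  ⟨HKOne.isInvertibleNonsingular hlam σ, HKOne.isErgodic hlam σ hlam1, HKOne.isTypeIII hlam σ hlam1⟩
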